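/- Theorem (rational variance function $V(m)=m/(\lambda(1-m))$). For $n\ge 0$ let $$H_n(x)=\sum_{j=0}^{\lfloor n/2\rfloor}\frac{(-1)^j\,n!}{j!\,(n-2j)!}\,(2x)^{n-2j}$$ be the Hermite polynomials, and for $\lambda>0$ put $\varphi_0(\lambda)=e^{-3\lambda/8}$ and, for $n\ge 1$, $$\varphi_n(\lambda)=\frac{e^{-3\lambda/8}}{2^n e^{n/2}\,n!}\sum_{k=0}^{n-1}\binom{n-1}{k}\,n^{\,n-1-k}\left(\frac{\lambda}{2}\right)^{(k+1)/2}H_{k+1}\!\left(\sqrt{\lambda/2}\right).$$ Then $\varphi_n(\lambda)\ge 0$ for all $n$, and $$\mu_\lambda=\sum_{n=0}^\infty\varphi_n(\lambda)\,\delta_{n/\lambda}$$ is an infinitely divisible probability law on $\mathbb R$. For a $\sigma$-finite positive measure $\nu$ on $\mathbb R$ that is not concentrated at a single point and for which the interior $\Theta_\nu$ of $\{\theta:\int e^{\theta u}\,\nu(du)<\infty\}$ is nonempty, the natural exponential family generated by $\nu$ is $$\mathcal F(\nu)=\Big\{P_\theta(du)=\frac{e^{\theta u}}{\int e^{\theta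 v}\nu(dv)}\,\nu(du):\ \theta\in\Theta_\nu\Big\};$$ it has variance function $V$ on the interval $I$ if the mean maps $\mathcal F(\nu)$ bijectively onto $I$ and every $P\in\mathcal F(\nu)$ has finite second moment and variance $V(m)$, where $m$ is the mean of $P$. For every $\lambda>0$ the measure $\mu_\lambda$ generates the natural exponential family with variance function $$V(m)=\frac{m}{\lambda(1-m)},\qquad 0<m<1,$$ that is, $\mathcal F(\mu_\lambda)$ has this variance function on $(0,1)$, and every natural exponential family with this variance function on $(0,1)$ equals $\mathcal F(\mu_\lambda)$. -/

import Mathlib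

open MeasureTheory ProbabilityTheory Set

noncomputable section

namespace RationalNEF

/-- The (physicists') Hermite polynomial
`H_n(x) = ∑_{j ≤ n/2} (-1)^j n! / (j! (n-2j)!) (2x)^(n-2j)`. -/
def hermiteH (n : ℕ) (x : ℝ) : ℝ :=
  ∑ j ∈ Finset.range (n / 2 + 1),
    (-1 : ℝ) ^ j * (n.factorial : ℝ) / ((j.factorial : ℝ) * ((n - 2 * j).factorial : ℝ))
      * (2 * x) ^ (n - 2 * j)

/-- The weights `φ_n(l)`. In the sum `k ≤ n - 1`, so that the natural subtractions are exact. -/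
def phi (n : ℕ) (l : ℝ) : ℝ :=
  if n = 0 then Real.exp (-3 * l / 8)
  else
    Real.exp (-3 * l / 8) / ((2 : ℝ) ^ n * Real.exp ((n : ℝ) / 2) * (n.factorial : ℝ)) *
      ∑ k ∈ Finset.range n,
        ((n - 1).choose k : ℝ) * (n : ℝ) ^ (n - 1 - k) *
          (l / 2) ^ (((k : ℝ) + 1) / 2) * hermiteH (k + 1) (Real.sqrt (l / 2))

/-- The discrete measure `∑_n φ_n(l) δ_{n/l}`. -/
def mu (l : ℝ) : Measure ℝ :=
  Measure.sum fun n : ℕ => ENNReal.ofReal (phi n l) • Measure.dirac ((n : ℝ) / l)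

/-- The `k`-fold convolution power of a measure on `ℝ`. -/
def convPow (ν : Measure ℝ) : ℕ → Measure ℝ
  | 0 => Measure.dirac 0
  | k + 1 => (convPow ν k).conv ν

/-- A probability law on `ℝ` is infinitely divisible if for every `k ≥ 1` it is the `k`-fold
convolution power of a probability law. -/
def IsInfinitelyDivisible (P : Measure ℝ) : Prop :=
  IsProbabilityMeasure P ∧
    ∀ k : ℕ, 1 ≤ k → ∃ ν : Measure ℝ, IsProbabilityMeasure ν ∧ convPow ν k = P

/-- The maximal open interval of parameters `θ` at which the Laplace transform
`L(θ) = ∫ exp (θ u) ν(du)` is finite. -/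
def naturalParam (ν : Measure ℝ) : Set ℝ := interior (integrableExpSet id ν)

/-- `ν` generates a natural exponential family: it is a positive, `σ`-finite, non-degenerate
measure (not concentrated at a point; in particular `ν ≠ 0`) whose Laplace transform is finite on
a nonempty open interval. -/
structure GeneratesNEF (ν : Measure ℝ) : Prop where
  sigmaFinite : SigmaFinite ν
  nondegenerate : ∀ a : ℝ, ν {a}ᶜ ≠ 0
  nonempty : (naturalParam ν).Nonempty

/-- The natural exponential family generated by `ν`: the probability measures
`P_θ(du) = exp (θ u) / L(θ) ν(du) = exp (θ u - log L(θ)) ν(du)`. -/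
def expFamily (ν : Measure ℝ) : Set (Measure ℝ) :=
  {P | ∃ θ ∈ naturalParam ν, P = ν.tilted fun u => θ * u}

/-- The family `F` of laws has domain of means `I`, is parametrized bijectively by its means, and
has variance function `V` on `I`. -/
def HasVarianceFunction (F : Set (Measure ℝ)) (I : Set ℝ) (V : ℝ → ℝ) : Prop :=
  Set.BijOn (fun P : Measure ℝ => ∫ u, u ∂P) F I ∧
    ∀ P ∈ F, MemLp (fun u : ℝ => u) 2 P ∧ ∫ u, (u - ∫ v, v ∂P) ^ 2 ∂P = V (∫ u, u ∂P)

end RationalNEF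

end

/-!
A family with variance function `V(m) = m / (l (1 - m))` has canonical parameter
`θ = ∫ dm / V(m) = l (log m - m) + const` and cumulant function
`∫ m dθ = l (m - m ^ 2 / 2) + const`. So in the variable `w = m exp (-m)`, which is proportional to
`exp (θ / l)`, its Laplace transform is proportional to `exp (l (m - m ^ 2 / 2))`. The proof makes
this explicit as a power series in `w`.

* The generating function `U(w) = ∑ n ^ (n - 2) w ^ n / n!` of labelled trees satisfies
  `U (m exp (-m)) = m - m ^ 2 / 2`. Coefficientwise this says that high finite differences of a
  power vanish (`sum_treeCoeff_mul_lambertCoeff`); it is summed for small `m` and continued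
  analytically to `0 ≤ m < 1` (`treeSum_mul_exp_neg`).
* Hence the Laplace transform has the coefficients of `exp (l U(w))`, which are nonnegative because
  those of `U` are. On the other hand `exp (l (t - t ^ 2 / 2))` is the generating function of the
  Hermite polynomials, and Lagrange inversion for `w = t exp (-t)` (`nat_mul_eq_of_sum_lambertCoeff`)
  turns its coefficients in `t` into those in `w`; this identifies them with `phi` (`phi_eq`).
* The series has radius of convergence `1 / e` in `w`, which corresponds to `m = 1`; this gives the
  parameter interval. Mean and variance then follow by differentiating the cumulant function along
  the parametrization by `m` (`deriv_cgf_mu`, `iteratedDeriv_two_cgf_mu`).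
* The exponent is linear in `l`, so `mu l` is infinitely divisible. Infinite divisibility and
  uniqueness both use that a law is determined by its moment generating function near `0`
  (`ext_of_mgf_eventuallyEq`).
-/

namespace RationalNEF

open Filter Topology

/-! ### Tree coefficients and finite differences -/

/-- The coefficient `n ^ (n - 2) / n!` of the exponential generating function of unrooted labelled
trees. It is written `n ^ n / (n ^ 2 n!)` to avoid a truncated exponent; at `n = 0` the division by
zero gives the intended value `0`. -/
noncomputable def treeCoeff (n : ℕ) : ℝ := (n : ℝ) ^ n / ((n : ℝ) ^ 2 * n.factorial)

lemma treeCoeff_zero : treeCoeff 0 = 0 := by simp [treeCoeff]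

lemma treeCoeff_nonneg (n : ℕ) : 0 ≤ treeCoeff n := by unfold treeCoeff; positivity

/-- The coefficient of `t ^ N` in `(t exp (-t)) ^ n`. -/
noncomputable def lambertCoeff (n N : ℕ) : ℝ :=
  if n ≤ N then (-(n : ℝ)) ^ (N - n) / (N - n).factorial else 0

/-- The coefficient form of `U (t exp (-t)) = t - t ^ 2 / 2`, where `U` is the tree series. Up to the
factor `N!` the left side is the `N`-th finite difference at `0` of `x ^ (N - 2)`, which vanishes
once `N ≥ 3`. -/
lemma sum_treeCoeff_mul_lambertCoeff (N : ℕ) :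
    ∑ n ∈ Finset.range (N + 1), treeCoeff n * lambertCoeff n N =
      if N = 1 then 1 else if N = 2 then -(1 / 2) else 0 := by
  rcases Nat.lt_or_ge N 3 with hN | hN
  · interval_cases N <;>
      norm_num [Finset.sum_range_succ, treeCoeff, lambertCoeff, Nat.factorial]
  · have h := congrFun (fwdDiff_iter_pow_eq_zero_of_lt (R := ℝ) (j := N - 2) (n := N)
      (by omega)) 0
    rw [fwdDiff_iter_eq_sum_shift] at h
    rw [if_neg (by omega), if_neg (by omega)]
    have hN' : (N.factorial : ℝ) ≠ 0 := by positivity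
    rw [← mul_right_inj' hN', mul_zero, Finset.mul_sum]
    rw [Pi.zero_apply] at h
    rw [← h]
    refine Finset.sum_congr rfl fun n hn => ?_
    have hn' : n ≤ N := by simpa [Nat.lt_succ_iff] using hn
    rcases Nat.eq_zero_or_pos n with rfl | hn0
    -- the term `0 ^ (N - 2)` of the finite difference vanishes because `N > 2`
    · simp [treeCoeff_zero, show N - 2 ≠ 0 by omega]
    · obtain ⟨m, rfl⟩ := Nat.exists_eq_add_of_le hn'
      have hn1 : (n : ℝ) ≠ 0 := by positivity
      have e : (n : ℝ) ^ (n + m - 2) = (n : ℝ) ^ n * (n : ℝ) ^ m / (n : ℝ) ^ 2 := by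
        rw [eq_div_iff (by positivity), ← pow_add, ← pow_add]; congr 1; omega
      simp only [treeCoeff, lambertCoeff, hn', if_true, add_tsub_cancel_left, zero_add,
        nsmul_eq_mul, mul_one, zsmul_eq_mul]
      push_cast
      rw [e, Nat.cast_choose ℝ hn', neg_pow (n : ℝ) m, add_tsub_cancel_left]
      field_simp

/-! ### The series `exp (l U)` and its composition with `t exp (-t)` -/

open PowerSeries in
/-- The power series `t exp (-t)`. -/
noncomputable def lambertSeries : PowerSeries ℝ := X * rescale (-1) (exp ℝ)

lemma coeff_lambertSeries_pow (n N : ℕ) :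
    PowerSeries.coeff N (lambertSeries ^ n) = lambertCoeff n N := by
  rw [lambertSeries, mul_pow, ← map_pow, PowerSeries.exp_pow_eq_rescale_exp,
    PowerSeries.coeff_X_pow_mul', lambertCoeff]
  split_ifs
  · rw [PowerSeries.coeff_rescale, PowerSeries.coeff_rescale, PowerSeries.coeff_exp,
      neg_pow (n : ℝ)]
    simp [div_eq_mul_inv, mul_assoc]
  · rfl

lemma hasSubst_lambertSeries : PowerSeries.HasSubst lambertSeries :=
  PowerSeries.HasSubst.of_constantCoeff_zero' (by simp [lambertSeries])

lemma coeff_subst_lambertSeries (f : PowerSeries ℝ) (N : ℕ) :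
    PowerSeries.coeff N (f.subst lambertSeries) =
      ∑ n ∈ Finset.range (N + 1), PowerSeries.coeff n f * lambertCoeff n N := by
  rw [PowerSeries.coeff_subst' hasSubst_lambertSeries]
  simp only [coeff_lambertSeries_pow, smul_eq_mul]
  refine finsum_eq_sum_of_support_subset _ fun n hn => ?_
  by_contra h
  apply hn
  have : ¬ n ≤ N := by simpa [Nat.lt_succ_iff] using h
  simp [lambertCoeff, this]

/-- The tree series `U = ∑ treeCoeff n X ^ n`. -/
noncomputable def treeSeries : PowerSeries ℝ := PowerSeries.mk treeCoeff

open PowerSeries in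
lemma treeSeries_subst_lambertSeries :
    treeSeries.subst lambertSeries = X * (1 + C (-(1 / 2) : ℝ) * X) := by
  ext N
  rw [coeff_subst_lambertSeries]
  simp only [treeSeries, coeff_mk, sum_treeCoeff_mul_lambertCoeff]
  rcases N with _ | _ | _ | N
  · simp
  · simp [coeff_succ_X_mul]
  · simp [coeff_succ_X_mul, coeff_one]
  · simp [coeff_succ_X_mul, coeff_one]

lemma coeff_treeSeries_pow_eq_zero {n k : ℕ} (h : n < k) :
    PowerSeries.coeff n (treeSeries ^ k) = 0 := by
  apply PowerSeries.coeff_of_lt_order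
  refine lt_of_lt_of_le (Nat.cast_lt.2 h) ?_
  exact PowerSeries.le_order_pow_of_constantCoeff_eq_zero k
    (by simp [treeSeries, treeCoeff_zero])

lemma coeff_treeSeries_pow_nonneg (n k : ℕ) : 0 ≤ PowerSeries.coeff n (treeSeries ^ k) := by
  induction k generalizing n with
  | zero => rw [pow_zero, PowerSeries.coeff_one]; split_ifs <;> norm_num
  | succ k ih =>
    rw [pow_succ, PowerSeries.coeff_mul]
    exact Finset.sum_nonneg fun p _ =>
      mul_nonneg (ih _) (by simpa [treeSeries] using treeCoeff_nonneg _)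

/-- The coefficient of `w ^ n` in `exp (l U(w))`. The sum over the powers `U ^ k` stops at `k = n`
because `U` has no constant term. -/
noncomputable def forestCoeff (l : ℝ) (n : ℕ) : ℝ :=
  ∑ k ∈ Finset.range (n + 1), l ^ k / k.factorial * PowerSeries.coeff n (treeSeries ^ k)

lemma forestCoeff_nonneg {l : ℝ} (hl : 0 ≤ l) (n : ℕ) : 0 ≤ forestCoeff l n :=
  Finset.sum_nonneg fun k _ => mul_nonneg (by positivity) (coeff_treeSeries_pow_nonneg n k)

lemma forestCoeff_eq_sum {l : ℝ} {n N : ℕ} (h : n ≤ N) : forestCoeff l n =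
    ∑ k ∈ Finset.range (N + 1), l ^ k / k.factorial * PowerSeries.coeff n (treeSeries ^ k) := by
  refine Finset.sum_subset (Finset.range_subset_range.2 (by omega)) fun k _ hk => ?_
  rw [coeff_treeSeries_pow_eq_zero (by simpa using hk), mul_zero]

/-- The coefficient of `t ^ N` in `exp (l (t - t ^ 2 / 2))`, which is
`(l / 2) ^ (N / 2) H_N (√(l / 2)) / N!`. -/
noncomputable def hermiteCoeff (l : ℝ) (N : ℕ) : ℝ :=
  ∑ j ∈ Finset.range (N / 2 + 1),
    l ^ (N - j) * (-(1 / 2)) ^ j / (j.factorial * (N - 2 * j).factorial)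

open PowerSeries in
lemma coeff_quadratic_pow (N k : ℕ) :
    coeff N ((X * (1 + C (-(1 / 2) : ℝ) * X)) ^ k) =
      if k ≤ N then (k.choose (N - k) : ℝ) * (-(1 / 2)) ^ (N - k) else 0 := by
  rw [mul_pow, coeff_X_pow_mul']
  split_ifs with h
  · have : (1 + C (-(1 / 2) : ℝ) * X) = rescale (-(1 / 2) : ℝ) (1 + X) := by
      simp [rescale_X]
    rw [this, ← map_pow, coeff_rescale, add_comm 1 X, mul_comm]
    congr 1
    have : ((X + 1 : PowerSeries ℝ) ^ k) = (((Polynomial.X + 1 : Polynomial ℝ) ^ k :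
      Polynomial ℝ) : PowerSeries ℝ) := by simp
    rw [this, Polynomial.coeff_coe, Polynomial.coeff_X_add_one_pow]
  · rfl

/-- The coefficient form of `exp (l U(t exp (-t))) = exp (l (t - t ^ 2 / 2))`. -/
lemma sum_forestCoeff_mul_lambertCoeff (l : ℝ) (N : ℕ) :
    ∑ n ∈ Finset.range (N + 1), forestCoeff l n * lambertCoeff n N = hermiteCoeff l N := by
  have h1 : ∑ n ∈ Finset.range (N + 1), forestCoeff l n * lambertCoeff n N =
      ∑ k ∈ Finset.range (N + 1), l ^ k / k.factorial *
        PowerSeries.coeff N ((treeSeries ^ k).subst lambertSeries) := by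
    simp only [coeff_subst_lambertSeries, Finset.mul_sum]
    rw [Finset.sum_comm]
    refine Finset.sum_congr rfl fun n hn => ?_
    rw [forestCoeff_eq_sum (N := N) (by simpa [Nat.lt_succ_iff] using hn), Finset.sum_mul]
    simp only [mul_assoc]
  rw [h1, hermiteCoeff]
  simp only [PowerSeries.subst_pow hasSubst_lambertSeries, treeSeries_subst_lambertSeries,
    coeff_quadratic_pow]
  -- `k = N - j` matches the binomial expansion of `(t - t ^ 2 / 2) ^ k` with the Hermite sum;
  -- the terms with `2 j > N` vanish
  rw [← Finset.sum_range_reflect]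
  symm
  refine Finset.sum_subset_zero_on_sdiff (Finset.range_subset_range.2 (by omega)) ?_ ?_
  · intro j hj
    simp only [Finset.mem_sdiff, Finset.mem_range] at hj
    rw [Nat.choose_eq_zero_of_lt (by omega)]
    simp
  · intro j hj
    simp only [Finset.mem_range] at hj
    have e1 : N + 1 - 1 - j = N - j := by omega
    have e2 : N - (N - j) = j := by omega
    have e3 : N - j - j = N - 2 * j := by omega
    rw [e1, if_pos (by omega), e2, Nat.cast_choose ℝ (by omega : j ≤ N - j), e3]
    field_simp

/-! ### Lagrange inversion for `t exp (-t)` -/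

lemma sum_pow_div_factorial_mul (x y : ℝ) (M : ℕ) :
    ∑ r ∈ Finset.range (M + 1), x ^ r / r.factorial * (y ^ (M - r) / (M - r).factorial) =
      (x + y) ^ M / M.factorial := by
  rw [add_pow, Finset.sum_div]
  refine Finset.sum_congr rfl fun r hr => ?_
  rw [Nat.cast_choose ℝ (by simpa [Nat.lt_succ_iff] using hr)]
  field_simp

lemma sum_mul_pow_div_factorial_mul (x y : ℝ) (M : ℕ) :
    ∑ r ∈ Finset.range (M + 2), r * (x ^ r / r.factorial) *
        (y ^ (M + 1 - r) / (M + 1 - r).factorial) = x * ((x + y) ^ M / M.factorial) := by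
  rw [Finset.sum_range_succ', ← sum_pow_div_factorial_mul, Finset.mul_sum]
  simp only [Nat.cast_zero, zero_mul, add_zero]
  refine Finset.sum_congr rfl fun r _ => ?_
  rw [Nat.factorial_succ, Nat.add_sub_add_right]
  push_cast
  field_simp
  ring

/-- The coefficient of `t ^ (n - 1)` in the product of `exp (n t)` and the derivative of
`(t exp (-t)) ^ m`. It vanishes for `m < n`, which is the orthogonality behind Lagrange inversion. -/
lemma sum_mul_lambertCoeff_mul {m n : ℕ} (hmn : m ≤ n) :
    ∑ K ∈ Finset.range (n + 1), K * lambertCoeff m K *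
      ((n : ℝ) ^ (n - K) / (n - K).factorial) = if m = n then (n : ℝ) else 0 := by
  obtain ⟨M, rfl⟩ := Nat.exists_eq_add_of_le hmn
  rw [show m + M + 1 = m + (M + 1) by ring, Finset.sum_range_add, Finset.sum_eq_zero, zero_add]
  · have h1 : ∀ r ∈ Finset.range (M + 1), ((m + r : ℕ) : ℝ) * lambertCoeff m (m + r) *
        (((m + M : ℕ) : ℝ) ^ (m + M - (m + r)) / (m + M - (m + r)).factorial) =
        m * ((-(m : ℝ)) ^ r / r.factorial * (((m + M : ℕ) : ℝ) ^ (M - r) / (M - r).factorial)) +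
        r * ((-(m : ℝ)) ^ r / r.factorial) *
          (((m + M : ℕ) : ℝ) ^ (M - r) / (M - r).factorial) := by
      intro r _
      rw [lambertCoeff, if_pos (by omega), Nat.add_sub_add_left, add_tsub_cancel_left]
      push_cast
      ring
    rw [Finset.sum_congr rfl h1, Finset.sum_add_distrib, ← Finset.mul_sum,
      sum_pow_div_factorial_mul]
    rcases M with _ | M
    · simp
    · rw [sum_mul_pow_div_factorial_mul, if_neg (by omega), Nat.factorial_succ]
      push_cast
      field_simp
      ring
  · intro K hK
    rw [lambertCoeff, if_neg (by simpa using hK)]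
    simp

/-- Lagrange inversion: if `∑ b n (t exp (-t)) ^ n = ∑ g N t ^ N` as formal series, then `n b n` is
the coefficient of `t ^ (n - 1)` in `g'(t) exp (n t)`. -/
lemma nat_mul_eq_of_sum_lambertCoeff {b g : ℕ → ℝ}
    (h : ∀ N, ∑ n ∈ Finset.range (N + 1), b n * lambertCoeff n N = g N) (n : ℕ) :
    ∑ K ∈ Finset.range (n + 1), K * g K * ((n : ℝ) ^ (n - K) / (n - K).factorial) = n * b n := by
  have h2 : ∀ K ∈ Finset.range (n + 1),
      K * g K * ((n : ℝ) ^ (n - K) / (n - K).factorial) = ∑ m ∈ Finset.range (n + 1),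
        b m * (K * lambertCoeff m K * ((n : ℝ) ^ (n - K) / (n - K).factorial)) := by
    intro K hK
    have : g K = ∑ m ∈ Finset.range (n + 1), b m * lambertCoeff m K := by
      rw [← h K]
      refine Finset.sum_subset (Finset.range_subset_range.2 (by simpa using hK)) fun m _ hm => ?_
      rw [lambertCoeff, if_neg (by simpa [Nat.lt_succ_iff] using hm), mul_zero]
    rw [this, Finset.mul_sum, Finset.sum_mul]
    exact Finset.sum_congr rfl fun m _ => by ring
  rw [Finset.sum_congr rfl h2, Finset.sum_comm]
  simp only [← Finset.mul_sum]
  rw [Finset.sum_eq_single n]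
  · rw [sum_mul_lambertCoeff_mul le_rfl, if_pos rfl, mul_comm]
  · intro m hm hmn
    rw [sum_mul_lambertCoeff_mul (by simpa [Nat.lt_succ_iff] using hm), if_neg hmn, mul_zero]
  · simp

lemma rpow_mul_hermiteH {l : ℝ} (hl : 0 < l) (N : ℕ) :
    (l / 2) ^ ((N : ℝ) / 2) * hermiteH N (Real.sqrt (l / 2)) = N.factorial * hermiteCoeff l N := by
  have e : (l / 2) ^ ((N : ℝ) / 2) = Real.sqrt (l / 2) ^ N := by
    rw [Real.sqrt_eq_rpow, ← Real.rpow_natCast, ← Real.rpow_mul (by positivity)]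
    congr 1; ring
  rw [e, hermiteH, hermiteCoeff, Finset.mul_sum, Finset.mul_sum]
  refine Finset.sum_congr rfl fun j hj => ?_
  have hj' : 2 * j ≤ N := by simp only [Finset.mem_range] at hj; omega
  have key : Real.sqrt (l / 2) ^ N * (2 * Real.sqrt (l / 2)) ^ (N - 2 * j) =
      l ^ (N - j) * (1 / 2) ^ j := by
    obtain ⟨m, rfl⟩ := Nat.exists_eq_add_of_le hj'
    rw [add_tsub_cancel_left, mul_pow, show 2 * j + m - j = j + m by omega]
    have hs : Real.sqrt (l / 2) ^ 2 = l / 2 := Real.sq_sqrt (by positivity)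
    calc _ = (Real.sqrt (l / 2) ^ 2) ^ (j + m) * 2 ^ m := by ring
      _ = _ := by
        rw [hs, div_pow, pow_add 2, one_div, inv_pow]
        field_simp
  rw [neg_pow (1 / 2 : ℝ)]
  calc _ = (-1) ^ j * N.factorial / (j.factorial * (N - 2 * j).factorial) *
      (Real.sqrt (l / 2) ^ N * (2 * Real.sqrt (l / 2)) ^ (N - 2 * j)) := by ring
    _ = _ := by rw [key]; ring

/-- The weight `phi n l` is the coefficient of `w ^ n` in `exp (l U(w))`, rescaled by
`w = z / (2 √e)` and normalized to total mass one. -/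
lemma phi_eq {l : ℝ} (hl : 0 < l) (n : ℕ) :
    phi n l = Real.exp (-3 * l / 8) * ((1 / 2) * Real.exp (-(1 / 2))) ^ n * forestCoeff l n := by
  rcases Nat.eq_zero_or_pos n with rfl | hn
  · simp [phi, forestCoeff]
  have h := nat_mul_eq_of_sum_lambertCoeff (sum_forestCoeff_mul_lambertCoeff l) n
  rw [Finset.sum_range_succ', Nat.cast_zero, zero_mul, zero_mul, add_zero] at h
  have hn' : (n : ℝ) ≠ 0 := by positivity
  rw [phi, if_neg hn.ne', ← mul_right_inj' hn']
  have h3 : ∑ k ∈ Finset.range n, ((n - 1).choose k : ℝ) * (n : ℝ) ^ (n - 1 - k) *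
      (l / 2) ^ (((k : ℝ) + 1) / 2) * hermiteH (k + 1) (Real.sqrt (l / 2)) =
      (n - 1).factorial * (n * forestCoeff l n) := by
    rw [← h, Finset.mul_sum]
    refine Finset.sum_congr rfl fun k hk => ?_
    have hk' : k ≤ n - 1 := by simp only [Finset.mem_range] at hk; omega
    have := rpow_mul_hermiteH hl (k + 1)
    push_cast at this
    rw [mul_assoc, this, Nat.cast_choose ℝ hk', Nat.factorial_succ,
      show n - (k + 1) = n - 1 - k by omega]
    push_cast
    field_simp
  rw [h3, ← Nat.mul_factorial_pred hn.ne', mul_pow, ← Real.exp_nat_mul,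
    show (n : ℝ) * -(1 / 2) = -(n / 2) by ring, Real.exp_neg (n / 2 : ℝ)]
  push_cast
  rw [one_div, inv_pow]
  field_simp

/-! ### Summation of the tree series -/

lemma tendsto_treeCoeff_ratio :
    Tendsto (fun n => ‖treeCoeff n.succ‖ / ‖treeCoeff n‖) atTop (𝓝 (Real.exp 1)) := by
  have h1 := Real.tendsto_one_add_div_pow_exp 1
  have h2 : Tendsto (fun n : ℕ => ((n : ℝ) / (n + 1)) ^ 2) atTop (𝓝 (1 ^ 2)) :=
    (tendsto_natCast_div_add_atTop (1 : ℝ)).pow 2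
  have h3 := h1.mul h2
  rw [one_pow, mul_one] at h3
  refine h3.congr' ?_
  filter_upwards [eventually_gt_atTop 0] with n hn
  rw [Real.norm_of_nonneg (treeCoeff_nonneg _), Real.norm_of_nonneg (treeCoeff_nonneg _),
    treeCoeff, treeCoeff, Nat.succ_eq_add_one, Nat.factorial_succ]
  have hn' : (n : ℝ) ≠ 0 := by positivity
  have : (1 + 1 / (n : ℝ)) = (n + 1) / n := by field_simp
  rw [this, div_pow, div_pow]
  push_cast
  field_simp
  ring

/-- The sum `U(w)` of the tree series; it is meaningful for `|w| < exp (-1)`. -/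
noncomputable def treeSum (w : ℝ) : ℝ := ∑' n, treeCoeff n * w ^ n

lemma radius_treeCoeff :
    (FormalMultilinearSeries.ofScalars ℝ treeCoeff).radius = ENNReal.ofReal (Real.exp (-1)) := by
  have h := FormalMultilinearSeries.ofScalars_radius_eq_inv_of_tendsto ℝ treeCoeff
    (r := Real.toNNReal (Real.exp 1)) (by simp [Real.exp_pos])
    (by rw [Real.coe_toNNReal _ (Real.exp_pos 1).le]; exact tendsto_treeCoeff_ratio)
  rw [h, ENNReal.ofReal, Real.exp_neg, Real.toNNReal_inv]

lemma hasFPowerSeriesOnBall_treeSum : HasFPowerSeriesOnBall treeSum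
    (FormalMultilinearSeries.ofScalars ℝ treeCoeff) 0 (ENNReal.ofReal (Real.exp (-1))) := by
  have h := (FormalMultilinearSeries.ofScalars ℝ treeCoeff).hasFPowerSeriesOnBall
    (by rw [radius_treeCoeff]; simp [Real.exp_pos])
  rw [radius_treeCoeff] at h
  refine h.congr fun w _ => ?_
  exact FormalMultilinearSeries.ofScalars_sum_eq treeCoeff w

lemma mem_eball_of_abs_lt {w : ℝ} (hw : |w| < Real.exp (-1)) :
    w ∈ Metric.eball (0 : ℝ) (ENNReal.ofReal (Real.exp (-1))) := by
  rw [Metric.mem_eball, edist_zero_right, ← ofReal_norm, Real.norm_eq_abs]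
  exact (ENNReal.ofReal_lt_ofReal_iff (Real.exp_pos _)).2 hw

lemma summable_treeCoeff {w : ℝ} (hw : |w| < Real.exp (-1)) :
    Summable fun n => treeCoeff n * w ^ n := by
  have h := (FormalMultilinearSeries.ofScalars ℝ treeCoeff).summable (x := w)
    (by rw [radius_treeCoeff]; exact mem_eball_of_abs_lt hw)
  simpa [FormalMultilinearSeries.ofScalars_apply_eq, mul_comm] using h

lemma not_summable_treeCoeff {w : ℝ} (hw : Real.exp (-1) < w) :
    ¬ Summable fun n => treeCoeff n * w ^ n := by
  intro h
  have hw0 : 0 < w := (Real.exp_pos _).trans hw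
  have := (FormalMultilinearSeries.ofScalars ℝ treeCoeff).le_radius_of_summable_norm
    (r := Real.toNNReal w) (by
      simpa [FormalMultilinearSeries.ofScalars_norm, Real.norm_of_nonneg (treeCoeff_nonneg _),
        hw0.le] using h)
  rw [radius_treeCoeff, ← ENNReal.ofReal, ENNReal.ofReal_le_ofReal_iff (Real.exp_pos _).le] at this
  linarith

lemma hasSum_shifted_exp (n : ℕ) (x t : ℝ) :
    HasSum (fun N => (if n ≤ N then x ^ (N - n) / (N - n).factorial else 0) * t ^ N)
      (t ^ n * Real.exp (x * t)) := by
  have h := (NormedSpace.expSeries_div_hasSum_exp (x * t)).mul_left (t ^ n)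
  rw [← Real.exp_eq_exp_ℝ] at h
  rw [← (add_left_injective n).hasSum_iff]
  · refine h.congr_fun fun j => ?_
    simp only [Function.comp_apply, le_add_iff_nonneg_left, zero_le, if_true,
      add_tsub_cancel_right, mul_pow, pow_add]
    ring
  · intro N hN
    rw [if_neg fun h => hN ⟨N - n, Nat.sub_add_cancel h⟩, zero_mul]

lemma hasSum_lambertCoeff (n : ℕ) (t : ℝ) :
    HasSum (fun N => lambertCoeff n N * t ^ N) ((t * Real.exp (-t)) ^ n) := by
  have h := hasSum_shifted_exp n (-n) t
  rwa [neg_mul, ← mul_neg, Real.exp_nat_mul, ← mul_pow] at h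

lemma hasSum_abs_lambertCoeff (n : ℕ) (t : ℝ) :
    HasSum (fun N => |lambertCoeff n N * t ^ N|) ((|t| * Real.exp |t|) ^ n) := by
  have h := hasSum_shifted_exp n n |t|
  rw [Real.exp_nat_mul, ← mul_pow] at h
  refine h.congr_fun fun N => ?_
  rw [abs_mul, abs_pow, lambertCoeff]
  split_ifs <;> simp [abs_div]

lemma mul_exp_neg_lt {t : ℝ} (ht : t < 1) : t * Real.exp (-t) < Real.exp (-1) := by
  have h : t < Real.exp (t - 1) := by
    have := Real.add_one_lt_exp (x := t - 1) (by linarith)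
    linarith
  calc t * Real.exp (-t) < Real.exp (t - 1) * Real.exp (-t) := by gcongr
    _ = Real.exp (-1) := by rw [← Real.exp_add]; congr 1; ring

/-- Near `0` the double series obtained by expanding `U (t exp (-t))` in powers of `t` converges
absolutely, and summing it in the other order gives the finite differences of
`sum_treeCoeff_mul_lambertCoeff`. -/
lemma treeSum_mul_exp_neg_of_small {t : ℝ} (ht : |t| * Real.exp |t| < Real.exp (-1)) :
    treeSum (t * Real.exp (-t)) = t - t ^ 2 / 2 := by
  have hsum : Summable fun p : ℕ × ℕ => treeCoeff p.1 * (lambertCoeff p.1 p.2 * t ^ p.2) := by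
    refine Summable.of_norm ?_
    have e : ∀ p : ℕ × ℕ, ‖treeCoeff p.1 * (lambertCoeff p.1 p.2 * t ^ p.2)‖ =
        treeCoeff p.1 * |lambertCoeff p.1 p.2 * t ^ p.2| := fun p => by
      rw [Real.norm_eq_abs, abs_mul, abs_of_nonneg (treeCoeff_nonneg p.1)]
    simp only [e]
    have h : ∀ n, HasSum (fun N => treeCoeff n * |lambertCoeff n N * t ^ N|)
      (treeCoeff n * (|t| * Real.exp |t|) ^ n) := fun n => (hasSum_abs_lambertCoeff n t).mul_left _
    refine (summable_prod_of_nonneg fun p => ?_).2 ⟨fun n => (h n).summable, ?_⟩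
    · exact mul_nonneg (treeCoeff_nonneg _) (abs_nonneg _)
    · simp only [(h _).tsum_eq]
      exact summable_treeCoeff (by rwa [abs_of_nonneg (by positivity)])
  have h1 := hsum.hasSum.prod_fiberwise fun n => (hasSum_lambertCoeff n t).mul_left (treeCoeff n)
  have h2 := ((Equiv.prodComm ℕ ℕ).hasSum_iff.2 hsum.hasSum).prod_fiberwise
    (g := fun N => (if N = 1 then 1 else if N = 2 then -(1 / 2) else 0) * t ^ N) fun N => by
      rw [← sum_treeCoeff_mul_lambertCoeff, Finset.sum_mul]
      simp only [Function.comp_apply, Equiv.prodComm_apply, Prod.swap, ← mul_assoc]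
      refine hasSum_sum_of_ne_finset_zero fun n hn => ?_
      rw [lambertCoeff, if_neg (by simpa [Nat.lt_succ_iff] using hn)]
      simp
  have h3 : HasSum (fun N => (if N = 1 then 1 else if N = 2 then -(1 / 2) else 0) * t ^ N)
      (t - t ^ 2 / 2) := by
    have := hasSum_sum_of_ne_finset_zero (L := .unconditional _) (s := Finset.range 3)
      (f := fun N => (if N = 1 then 1 else if N = 2 then -(1 / 2) else 0) * t ^ N) fun N hN => by
        simp only [Finset.mem_range] at hN
        rw [if_neg (by omega), if_neg (by omega), zero_mul]
    convert this using 1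
    norm_num [Finset.sum_range_succ]
    ring
  rw [treeSum, h1.tsum_eq, ← h3.unique h2]

/-- Both sides are analytic on `[0, 1)`, where `t exp (-t)` stays inside the disc of convergence, so
the identity near `0` extends. -/
lemma treeSum_mul_exp_neg {t : ℝ} (ht0 : 0 ≤ t) (ht : t < 1) :
    treeSum (t * Real.exp (-t)) = t - t ^ 2 / 2 := by
  have hf : AnalyticOnNhd ℝ (fun t => treeSum (t * Real.exp (-t))) (Ico 0 1) := by
    intro t ht
    have h1 : AnalyticAt ℝ treeSum (t * Real.exp (-t)) := by
      refine hasFPowerSeriesOnBall_treeSum.analyticAt_of_mem (mem_eball_of_abs_lt ?_)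
      rw [abs_of_nonneg (mul_nonneg ht.1 (Real.exp_pos _).le)]
      exact mul_exp_neg_lt ht.2
    exact h1.fun_comp (f := fun t : ℝ => t * Real.exp (-t)) (by fun_prop)
  have hg : AnalyticOnNhd ℝ (fun t : ℝ => t - t ^ 2 / 2) (Ico 0 1) := fun t _ => by fun_prop
  refine hf.eqOn_of_preconnected_of_eventuallyEq hg isPreconnected_Ico (z₀ := 0) (by simp) ?_
    ⟨ht0, ht⟩
  have : ∀ᶠ t : ℝ in 𝓝 0, |t| * Real.exp |t| < Real.exp (-1) := by
    refine ContinuousAt.eventually_lt (by fun_prop) continuousAt_const ?_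
    simp [Real.exp_pos]
  filter_upwards [this] with t ht using treeSum_mul_exp_neg_of_small ht

lemma hasSum_coeff_treeSeries_pow {w : ℝ} (hw : |w| < Real.exp (-1)) (k : ℕ) :
    Summable (fun n => ‖PowerSeries.coeff n (treeSeries ^ k) * w ^ n‖) ∧
    HasSum (fun n => PowerSeries.coeff n (treeSeries ^ k) * w ^ n) (treeSum w ^ k) := by
  induction k with
  | zero =>
    have h : ∀ n ∉ ({0} : Finset ℕ), PowerSeries.coeff n (treeSeries ^ 0) * w ^ n = 0 := by
      intro n hn
      rw [pow_zero, PowerSeries.coeff_one, if_neg (by simpa using hn), zero_mul]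
    have h2 := hasSum_sum_of_ne_finset_zero (L := .unconditional _) h
    simp only [Finset.sum_singleton, pow_zero, PowerSeries.coeff_one, if_true, mul_one] at h2
    simp only [pow_zero, PowerSeries.coeff_one]
    exact ⟨h2.summable.norm, h2⟩
  | succ k ih =>
    have hs : Summable fun n => ‖treeCoeff n * w ^ n‖ := (summable_treeCoeff hw).norm
    have e : ∀ n, PowerSeries.coeff n (treeSeries ^ (k + 1)) * w ^ n =
        ∑ p ∈ Finset.HasAntidiagonal.antidiagonal n, PowerSeries.coeff p.1 (treeSeries ^ k) * w ^ p.1 *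
          (treeCoeff p.2 * w ^ p.2) := by
      intro n
      rw [pow_succ, PowerSeries.coeff_mul, Finset.sum_mul]
      refine Finset.sum_congr rfl fun p hp => ?_
      rw [← Finset.HasAntidiagonal.mem_antidiagonal.1 hp, pow_add, treeSeries, PowerSeries.coeff_mk]
      ring
    simp only [e]
    have h1 := summable_norm_sum_mul_antidiagonal_of_summable_norm ih.1 hs
    refine ⟨h1, ?_⟩
    have h2 := tsum_mul_tsum_eq_tsum_sum_antidiagonal_of_summable_norm ih.1 hs
    rw [ih.2.tsum_eq, ← treeSum, ← pow_succ] at h2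
    rw [h2]
    exact h1.of_norm.hasSum

/-- Since all coefficients are nonnegative, the double series for `exp (l U(w))` may be summed in
either order. -/
lemma hasSum_forestCoeff {l w : ℝ} (hl : 0 ≤ l) (hw0 : 0 ≤ w) (hw : w < Real.exp (-1)) :
    HasSum (fun n => forestCoeff l n * w ^ n) (Real.exp (l * treeSum w)) := by
  have hw' : |w| < Real.exp (-1) := by rwa [abs_of_nonneg hw0]
  have h1 : ∀ k, HasSum (fun n => l ^ k / k.factorial *
      (PowerSeries.coeff n (treeSeries ^ k) * w ^ n)) (l ^ k / k.factorial * treeSum w ^ k) :=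
    fun k => (hasSum_coeff_treeSeries_pow hw' k).2.mul_left _
  have h2 : HasSum (fun k : ℕ => l ^ k / k.factorial * treeSum w ^ k)
      (Real.exp (l * treeSum w)) := by
    have := NormedSpace.expSeries_div_hasSum_exp (l * treeSum w)
    rw [← Real.exp_eq_exp_ℝ] at this
    exact this.congr_fun fun k => by rw [mul_pow]; ring
  have h0 : ∀ k n, 0 ≤ l ^ k / k.factorial * (PowerSeries.coeff n (treeSeries ^ k) * w ^ n) :=
    fun k n => mul_nonneg (by positivity)
      (mul_nonneg (coeff_treeSeries_pow_nonneg n k) (by positivity))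
  have hsum : Summable fun p : ℕ × ℕ => l ^ p.1 / p.1.factorial *
      (PowerSeries.coeff p.2 (treeSeries ^ p.1) * w ^ p.2) := by
    refine (summable_prod_of_nonneg fun p => h0 p.1 p.2).2 ⟨fun k => (h1 k).summable, ?_⟩
    simp only [(h1 _).tsum_eq]
    exact h2.summable
  have h3 := hsum.hasSum.prod_fiberwise h1
  have h4 := ((Equiv.prodComm ℕ ℕ).hasSum_iff.2 hsum.hasSum).prod_fiberwise
    (g := fun n => forestCoeff l n * w ^ n) fun n => by
      rw [forestCoeff, Finset.sum_mul]
      simp only [Function.comp_apply, Equiv.prodComm_apply, Prod.swap, ← mul_assoc]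
      refine hasSum_sum_of_ne_finset_zero fun k hk => ?_
      rw [coeff_treeSeries_pow_eq_zero (by simpa [Nat.lt_succ_iff] using hk)]
      simp
  rwa [h2.unique h3]

/-- The term `k = 1` of `forestCoeff`; it bounds the radius of convergence of `exp (l U)` from above. -/
lemma mul_treeCoeff_le_forestCoeff {l : ℝ} (hl : 0 ≤ l) (n : ℕ) :
    l * treeCoeff n ≤ forestCoeff l n := by
  rcases Nat.eq_zero_or_pos n with rfl | hn
  · simpa [treeCoeff_zero] using forestCoeff_nonneg hl 0
  · have := Finset.single_le_sum (f := fun k => l ^ k / k.factorial *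
      PowerSeries.coeff n (treeSeries ^ k)) (s := Finset.range (n + 1))
      (fun k _ => mul_nonneg (by positivity) (coeff_treeSeries_pow_nonneg n k))
      (Finset.mem_range.2 (by omega : 1 < n + 1))
    rw [pow_one, pow_one, Nat.factorial_one, Nat.cast_one, div_one] at this
    rwa [treeSeries, PowerSeries.coeff_mk] at this

lemma not_summable_forestCoeff {l w : ℝ} (hl : 0 < l) (hw : Real.exp (-1) < w) :
    ¬ Summable fun n => forestCoeff l n * w ^ n := by
  intro h
  have hw0 : 0 < w := (Real.exp_pos _).trans hw
  refine not_summable_treeCoeff hw ((summable_mul_left_iff hl.ne').1 ?_)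
  refine h.of_nonneg_of_le (fun n => ?_) fun n => ?_
  · have := treeCoeff_nonneg n; positivity
  · rw [← mul_assoc]; gcongr; exact mul_treeCoeff_le_forestCoeff hl.le n

lemma hasSum_forestCoeff_mul_exp_neg {l t : ℝ} (hl : 0 ≤ l) (ht0 : 0 ≤ t) (ht : t < 1) :
    HasSum (fun n => forestCoeff l n * (t * Real.exp (-t)) ^ n)
      (Real.exp (l * (t - t ^ 2 / 2))) := by
  rw [← treeSum_mul_exp_neg ht0 ht]
  exact hasSum_forestCoeff hl (by positivity) (mul_exp_neg_lt ht)

/-! ### The Laplace transform of `mu l` -/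

lemma phi_nonneg {l : ℝ} (hl : 0 < l) (n : ℕ) : 0 ≤ phi n l := by
  rw [phi_eq hl]
  have := forestCoeff_nonneg hl.le n
  positivity

lemma phi_mul_exp {l : ℝ} (hl : 0 < l) (θ : ℝ) (n : ℕ) :
    phi n l * Real.exp (θ * (n / l)) = Real.exp (-3 * l / 8) *
      (forestCoeff l n * (1 / 2 * Real.exp (θ / l - 1 / 2)) ^ n) := by
  rw [phi_eq hl, show θ * (n / l) = n * (θ / l) by ring, Real.exp_nat_mul,
    show θ / l - 1 / 2 = -(1 / 2) + θ / l by ring, Real.exp_add]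
  ring

lemma lintegral_exp_mu {l : ℝ} (hl : 0 < l) (θ : ℝ) :
    ∫⁻ u, ENNReal.ofReal (Real.exp (θ * u)) ∂(mu l) =
      ∑' n, ENNReal.ofReal (Real.exp (-3 * l / 8) *
        (forestCoeff l n * (1 / 2 * Real.exp (θ / l - 1 / 2)) ^ n)) := by
  rw [mu, lintegral_sum_measure]
  refine tsum_congr fun n => ?_
  rw [lintegral_smul_measure, lintegral_dirac, smul_eq_mul,
    ← ENNReal.ofReal_mul (phi_nonneg hl n), phi_mul_exp hl]

lemma mu_term_nonneg {l : ℝ} (hl : 0 < l) (θ : ℝ) (n : ℕ) : 0 ≤ Real.exp (-3 * l / 8) *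
    (forestCoeff l n * (1 / 2 * Real.exp (θ / l - 1 / 2)) ^ n) := by
  have := forestCoeff_nonneg hl.le n
  positivity

lemma integrable_exp_mu_iff {l : ℝ} (hl : 0 < l) (θ : ℝ) :
    Integrable (fun u => Real.exp (θ * u)) (mu l) ↔
      Summable fun n => forestCoeff l n * (1 / 2 * Real.exp (θ / l - 1 / 2)) ^ n := by
  rw [← lintegral_ofReal_ne_top_iff_integrable (by fun_prop)
    (ae_of_all _ fun u => (Real.exp_pos _).le), lintegral_exp_mu hl,
    ← summable_mul_left_iff (Real.exp_pos (-3 * l / 8)).ne']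
  constructor
  · intro h
    refine (ENNReal.summable_toReal h).congr fun n => ?_
    rw [ENNReal.toReal_ofReal (mu_term_nonneg hl θ n)]
  · intro h
    rw [← ENNReal.ofReal_tsum_of_nonneg (mu_term_nonneg hl θ) h]
    exact ENNReal.ofReal_ne_top

lemma mgf_mu {l : ℝ} (hl : 0 < l) {θ s : ℝ}
    (h : HasSum (fun n => forestCoeff l n * (1 / 2 * Real.exp (θ / l - 1 / 2)) ^ n) s) :
    mgf id (mu l) θ = Real.exp (-3 * l / 8) * s := by
  have h' := h.mul_left (Real.exp (-3 * l / 8))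
  rw [mgf, integral_eq_lintegral_of_nonneg_ae (ae_of_all _ fun u => (Real.exp_pos _).le)
    (by fun_prop)]
  simp only [id_eq]
  rw [lintegral_exp_mu hl, ← ENNReal.ofReal_tsum_of_nonneg (mu_term_nonneg hl θ) h'.summable,
    h'.tsum_eq, ENNReal.toReal_ofReal (h'.nonneg (mu_term_nonneg hl θ))]

/-- The canonical parameter `θ` at which the member of the family generated by `mu l` has mean `t`. It
solves `dθ/dt = l (1 - t) / t = 1 / V(t)`, with the constant for which `θ = 0` at `t = 1 / 2`. -/
noncomputable def meanToParam (l t : ℝ) : ℝ := l * (Real.log t - t + Real.log 2 + 1 / 2)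

lemma half_mul_exp_meanToParam {l t : ℝ} (hl : 0 < l) (ht : 0 < t) :
    1 / 2 * Real.exp (meanToParam l t / l - 1 / 2) = t * Real.exp (-t) := by
  rw [meanToParam, mul_div_cancel_left₀ _ hl.ne',
    show Real.log t - t + Real.log 2 + 1 / 2 - 1 / 2 = Real.log t + Real.log 2 + -t by ring,
    Real.exp_add, Real.exp_add, Real.exp_log ht, Real.exp_log two_pos]
  ring

lemma integrable_exp_meanToParam {l t : ℝ} (hl : 0 < l) (ht0 : 0 < t) (ht : t < 1) :
    Integrable (fun u => Real.exp (meanToParam l t * u)) (mu l) := by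
  rw [integrable_exp_mu_iff hl, half_mul_exp_meanToParam hl ht0]
  exact (hasSum_forestCoeff_mul_exp_neg hl.le ht0.le ht).summable

lemma mgf_mu_meanToParam {l t : ℝ} (hl : 0 < l) (ht0 : 0 < t) (ht : t < 1) :
    mgf id (mu l) (meanToParam l t) = Real.exp (l * (t - t ^ 2 / 2 - 3 / 8)) := by
  have h := hasSum_forestCoeff_mul_exp_neg hl.le ht0.le ht
  rw [← half_mul_exp_meanToParam hl ht0] at h
  rw [mgf_mu hl h, ← Real.exp_add]
  congr 1
  ring

/-- The limit of `meanToParam l t` as `t → 1`: the right end of the parameter interval of `mu l`. -/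
noncomputable def paramBound (l : ℝ) : ℝ := l * (Real.log 2 - 1 / 2)

lemma paramBound_pos {l : ℝ} (hl : 0 < l) : 0 < paramBound l :=
  mul_pos hl (by linarith [Real.log_two_gt_d9])

lemma meanToParam_lt {l t : ℝ} (hl : 0 < l) (ht0 : 0 < t) (ht : t < 1) :
    meanToParam l t < paramBound l := by
  refine mul_lt_mul_of_pos_left ?_ hl
  have := Real.log_lt_sub_one_of_pos ht0 ht.ne
  linarith

lemma exists_meanToParam_eq {l θ : ℝ} (hl : 0 < l) (hθ : θ < paramBound l) :
    ∃ t ∈ Ioo (0 : ℝ) 1, meanToParam l t = θ := by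
  set x := θ / l - Real.log 2 - 1 / 2 with hx
  have hx1 : x < -1 := by
    have : θ / l < Real.log 2 - 1 / 2 := by rwa [div_lt_iff₀' hl]
    linarith
  have hcont : ContinuousOn (fun t => Real.log t - t) (Icc (Real.exp x) 1) :=
    (Real.continuousOn_log.mono fun t ht => ((Real.exp_pos x).trans_le ht.1).ne').sub
      continuousOn_id
  -- `log t - t` is below `x` at `t = exp x` and equals `-1 > x` at `t = 1`
  obtain ⟨t, ht, hteq⟩ := intermediate_value_Ioo (Real.exp_le_one_iff.2 (by linarith)) hcont
    (show x ∈ Ioo (Real.log (Real.exp x) - Real.exp x) (Real.log 1 - 1) by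
      rw [Real.log_exp, Real.log_one]
      exact ⟨by linarith [Real.exp_pos x], by linarith⟩)
  refine ⟨t, ⟨(Real.exp_pos x).trans ht.1, ht.2⟩, ?_⟩
  simp only at hteq
  rw [meanToParam, hteq, hx]
  field_simp
  ring

lemma not_integrable_exp_mu {l θ : ℝ} (hl : 0 < l) (hθ : paramBound l < θ) :
    ¬ Integrable (fun u => Real.exp (θ * u)) (mu l) := by
  rw [integrable_exp_mu_iff hl]
  refine not_summable_forestCoeff hl ?_
  have h : Real.log 2 - 1 / 2 < θ / l := by rwa [lt_div_iff₀' hl]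
  calc Real.exp (-1) = 1 / 2 * Real.exp (Real.log 2 - 1) := by
        rw [sub_eq_add_neg, Real.exp_add, Real.exp_log two_pos]; ring
    _ < _ := mul_lt_mul_of_pos_left (Real.exp_lt_exp.2 (by linarith)) (by norm_num)

lemma naturalParam_mu {l : ℝ} (hl : 0 < l) : naturalParam (mu l) = Iio (paramBound l) := by
  apply Subset.antisymm
  · rw [← interior_Iic]
    refine interior_mono fun θ hθ => ?_
    by_contra h
    exact not_integrable_exp_mu hl (not_le.1 h) hθ
  · refine interior_maximal (fun θ hθ => ?_) isOpen_Iio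
    obtain ⟨t, ht, rfl⟩ := exists_meanToParam_eq hl hθ
    exact integrable_exp_meanToParam hl ht.1 ht.2

lemma meanToParam_half (l : ℝ) : meanToParam l (1 / 2) = 0 := by
  rw [meanToParam, one_div, Real.log_inv]; ring

lemma isProbabilityMeasure_mu {l : ℝ} (hl : 0 < l) : IsProbabilityMeasure (mu l) := by
  -- the total mass is the Laplace transform at `θ = 0`, that is, at mean `1 / 2`
  have h := mgf_mu_meanToParam hl (t := 1 / 2) (by norm_num) (by norm_num)
  rw [meanToParam_half, mgf_zero'] at h
  norm_num at h
  exact ⟨(ENNReal.toReal_eq_one_iff _).1 h⟩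

lemma generatesNEF_mu {l : ℝ} (hl : 0 < l) : GeneratesNEF (mu l) := by
  have := isProbabilityMeasure_mu hl
  refine ⟨inferInstance, fun a ha => ?_, ?_⟩
  · have hatom : ∀ n, phi n l ≠ 0 → (n : ℝ) / l = a := by
      intro n hn
      by_contra hna
      rw [mu, Measure.sum_apply _ (measurableSet_singleton a).compl, ENNReal.tsum_eq_zero] at ha
      have := ha n
      simp only [Measure.smul_apply, smul_eq_mul, mul_eq_zero, ENNReal.ofReal_eq_zero] at this
      rcases this with h | h
      · exact hn (le_antisymm h (phi_nonneg hl n))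
      · rw [Measure.dirac_apply_of_mem (by exact hna)] at h
        exact one_ne_zero h
    -- the atoms at `0` and at `1 / l` both have positive mass
    have h0 := hatom 0 (by rw [phi_eq hl]; simp [forestCoeff])
    have h1 := hatom 1 (by
      rw [phi_eq hl]
      have : forestCoeff l 1 ≠ 0 := by
        have := mul_treeCoeff_le_forestCoeff hl.le 1
        norm_num [treeCoeff] at this
        linarith
      positivity)
    rw [← h1] at h0
    simp only [Nat.cast_zero, zero_div, Nat.cast_one, one_div, zero_eq_inv] at h0
    exact hl.ne h0
  · rw [naturalParam_mu hl]
    exact ⟨0, paramBound_pos hl⟩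

/-! ### The variance function of `mu l` -/

lemma hasDerivAt_meanToParam (l : ℝ) {t : ℝ} (ht : t ≠ 0) :
    HasDerivAt (meanToParam l) (l * (1 / t - 1)) t := by
  have := ((((Real.hasDerivAt_log ht).sub (hasDerivAt_id t)).add_const (Real.log 2)).add_const
    (1 / 2)).const_mul l
  rw [one_div]
  exact this

lemma cgf_mu_meanToParam {l t : ℝ} (hl : 0 < l) (ht0 : 0 < t) (ht : t < 1) :
    cgf id (mu l) (meanToParam l t) = l * (t - t ^ 2 / 2 - 3 / 8) := by
  rw [cgf, mgf_mu_meanToParam hl ht0 ht, Real.log_exp]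

lemma meanToParam_mem {l t : ℝ} (hl : 0 < l) (ht : t ∈ Ioo (0 : ℝ) 1) :
    meanToParam l t ∈ interior (integrableExpSet id (mu l)) := by
  have h : meanToParam l t ∈ naturalParam (mu l) := by
    rw [naturalParam_mu hl]; exact meanToParam_lt hl ht.1 ht.2
  exact h

/-- The chain rule for `cgf_mu_meanToParam`: the factor `dθ/dt = l (1 / t - 1)` does not vanish for
`t < 1`. -/
lemma deriv_cgf_mu {l t : ℝ} (hl : 0 < l) (ht : t ∈ Ioo (0 : ℝ) 1) :
    deriv (cgf id (mu l)) (meanToParam l t) = t := by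
  have h1 := (analyticAt_cgf (meanToParam_mem hl ht)).differentiableAt.hasDerivAt.comp t
    (hasDerivAt_meanToParam l ht.1.ne')
  have h2 : HasDerivAt (fun t : ℝ => l * (t - t ^ 2 / 2 - 3 / 8)) (l * (1 - t)) t := by
    have := ((((hasDerivAt_id t).sub (((hasDerivAt_id t).pow 2).div_const 2)).sub_const
      (3 / 8)).const_mul l)
    simpa using this
  have h3 := h1.congr_of_eventuallyEq (f₁ := fun t : ℝ => l * (t - t ^ 2 / 2 - 3 / 8)) (by
    filter_upwards [isOpen_Ioo.mem_nhds ht] with s hs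
    exact (cgf_mu_meanToParam hl hs.1 hs.2).symm)
  have h4 := h3.unique h2
  have ht1 : 1 - t ≠ 0 := by linarith [ht.2]
  have ht0 := ht.1.ne'
  have : l * (1 / t - 1) = l * (1 - t) / t := by field_simp
  rw [this, mul_div_assoc', div_eq_iff ht0, mul_comm _ t] at h4
  exact mul_right_cancel₀ (mul_ne_zero hl.ne' ht1) h4

lemma iteratedDeriv_two_cgf_mu {l t : ℝ} (hl : 0 < l) (ht : t ∈ Ioo (0 : ℝ) 1) :
    iteratedDeriv 2 (cgf id (mu l)) (meanToParam l t) = t / (l * (1 - t)) := by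
  rw [iteratedDeriv_succ, iteratedDeriv_one]
  have h1 := (analyticAt_cgf (meanToParam_mem hl ht)).deriv.differentiableAt.hasDerivAt.comp t
    (hasDerivAt_meanToParam l ht.1.ne')
  have h3 := h1.congr_of_eventuallyEq (f₁ := id) (by
    filter_upwards [isOpen_Ioo.mem_nhds ht] with s hs
    exact (deriv_cgf_mu hl hs).symm)
  have h4 := h3.unique (hasDerivAt_id t)
  have ht1 : 1 - t ≠ 0 := by linarith [ht.2]
  have ht0 := ht.1.ne'
  rw [eq_div_iff (mul_ne_zero hl.ne' ht1)]
  field_simp at h4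
  linarith

lemma mean_tilted {ν : Measure ℝ} {θ : ℝ} (hθ : θ ∈ naturalParam ν) :
    ∫ u, u ∂(ν.tilted fun u => θ * u) = deriv (cgf id ν) θ :=
  integral_tilted_mul_self (X := id) hθ

lemma variance_tilted {ν : Measure ℝ} {θ : ℝ} (hθ : θ ∈ naturalParam ν) :
    ∫ u, (u - ∫ v, v ∂(ν.tilted fun u => θ * u)) ^ 2 ∂(ν.tilted fun u => θ * u) =
      iteratedDeriv 2 (cgf id ν) θ := by
  rw [← variance_tilted_mul (X := id) hθ, variance_eq_integral]
  · rfl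
  · exact aemeasurable_id

lemma hasVarianceFunction_mu {l : ℝ} (hl : 0 < l) :
    HasVarianceFunction (expFamily (mu l)) (Ioo 0 1) (fun m => m / (l * (1 - m))) := by
  have key : ∀ P ∈ expFamily (mu l), ∃ t ∈ Ioo (0 : ℝ) 1,
      P = (mu l).tilted (fun u => meanToParam l t * u) ∧ ∫ u, u ∂P = t := by
    rintro P ⟨θ, hθ, rfl⟩
    obtain ⟨t, ht, rfl⟩ := exists_meanToParam_eq hl (by rwa [naturalParam_mu hl] at hθ)
    exact ⟨t, ht, rfl, by rw [mean_tilted hθ, deriv_cgf_mu hl ht]⟩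
  refine ⟨⟨fun P hP => ?_, fun P hP Q hQ hPQ => ?_, fun t ht => ?_⟩, fun P hP => ?_⟩
  · obtain ⟨t, ht, -, h⟩ := key P hP
    simpa only [h] using ht
  · obtain ⟨t, -, hP, h⟩ := key P hP
    obtain ⟨s, -, hQ, h'⟩ := key Q hQ
    simp only [h, h'] at hPQ
    rw [hP, hQ, hPQ]
  · exact ⟨_, ⟨meanToParam l t, meanToParam_mem hl ht, rfl⟩,
      by simp only [mean_tilted (meanToParam_mem hl ht), deriv_cgf_mu hl ht]⟩
  · obtain ⟨t, ht, rfl, h⟩ := key P hP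
    refine ⟨memLp_tilted_mul (X := id) (meanToParam_mem hl ht) 2, ?_⟩
    rw [variance_tilted (meanToParam_mem hl ht), iteratedDeriv_two_cgf_mu hl ht, h]

/-! ### Infinite divisibility -/

/-- Two laws whose moment generating functions are finite and equal near `0` coincide: the complex
moment generating functions agree on a vertical strip around the imaginary axis, hence so do the
characteristic functions. -/
lemma ext_of_mgf_eventuallyEq {P Q : Measure ℝ} [IsProbabilityMeasure P] [IsProbabilityMeasure Q]
    (hP : 0 ∈ interior (integrableExpSet id P)) (h : mgf id P =ᶠ[𝓝 0] mgf id Q) : P = Q := by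
  have hQ : 0 ∈ interior (integrableExpSet id Q) := by
    rw [mem_interior_iff_mem_nhds] at hP ⊢
    filter_upwards [hP, h] with s hs hs'
    have : 0 < mgf id Q s := hs' ▸ mgf_pos hs
    exact mgf_pos_iff.1 this
  have hsub : {z : ℂ | z.re ∈ interior (integrableExpSet id P) ∩ interior (integrableExpSet id Q)}
      ⊆ {z | z.re ∈ interior (integrableExpSet id P)} := fun z hz => hz.1
  have hsub' : {z : ℂ | z.re ∈ interior (integrableExpSet id P) ∩ interior (integrableExpSet id Q)}
      ⊆ {z | z.re ∈ interior (integrableExpSet id Q)} := fun z hz => hz.2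
  have heq : EqOn (complexMGF id P) (complexMGF id Q)
      {z : ℂ | z.re ∈ interior (integrableExpSet id P) ∩ interior (integrableExpSet id Q)} := by
    refine AnalyticOnNhd.eqOn_of_preconnected_of_frequently_eq
      (analyticOnNhd_complexMGF.mono hsub) (analyticOnNhd_complexMGF.mono hsub')
      ((convex_integrableExpSet.interior.inter
        convex_integrableExpSet.interior).linear_preimage Complex.reLm).isPreconnected
      (z₀ := 0) ⟨by simpa using hP, by simpa using hQ⟩ ?_
    have h1 : ∃ᶠ x : ℝ in 𝓝[≠] 0, complexMGF id P x = complexMGF id Q x := by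
      refine Eventually.frequently ?_
      filter_upwards [h.filter_mono nhdsWithin_le_nhds] with x hx
      rw [complexMGF_ofReal, complexMGF_ofReal, hx]
    have h2 : Tendsto (fun x : ℝ => (x : ℂ)) (𝓝[≠] 0) (𝓝[≠] 0) := by
      refine tendsto_nhdsWithin_iff.2 ⟨?_, ?_⟩
      · exact (Complex.continuous_ofReal.tendsto' 0 0 (by simp)).mono_left nhdsWithin_le_nhds
      · filter_upwards [self_mem_nhdsWithin] with x hx
        simpa using hx
    exact h2.frequently h1
  refine Measure.ext_of_charFun (funext fun t => ?_)
  rw [← complexMGF_id_mul_I, ← complexMGF_id_mul_I]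
  exact heq ⟨by simpa using hP, by simpa using hQ⟩

lemma mgf_conv (P Q : Measure ℝ) [SFinite P] [SFinite Q] (s : ℝ) :
    mgf id (P.conv Q) s = mgf id P s * mgf id Q s := by
  simp only [mgf, id_eq]
  rw [Measure.conv, integral_map (by fun_prop) (by fun_prop), ← integral_prod_mul]
  simp only [mul_add, Real.exp_add]

lemma isProbabilityMeasure_convPow (P : Measure ℝ) [IsProbabilityMeasure P] (k : ℕ) :
    IsProbabilityMeasure (convPow P k) := by
  induction k with
  | zero => rw [convPow]; infer_instance
  | succ k ih => rw [convPow]; infer_instance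

lemma mgf_convPow (P : Measure ℝ) [IsProbabilityMeasure P] (k : ℕ) (s : ℝ) :
    mgf id (convPow P k) s = mgf id P s ^ k := by
  induction k with
  | zero => simp [convPow, mgf]
  | succ k ih =>
    have := isProbabilityMeasure_convPow P k
    rw [convPow, mgf_conv, ih, pow_succ]

/-- The cumulant function of `mu l` is proportional to `l` up to the scaling of the atoms, so the
`k`-th root is `mu (l / k)` with its atoms `n k / l` moved to `n / l`. -/
lemma isInfinitelyDivisible_mu {l : ℝ} (hl : 0 < l) : IsInfinitelyDivisible (mu l) := by
  have hμ := isProbabilityMeasure_mu hl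
  refine ⟨hμ, fun k hk => ?_⟩
  have hk' : (0 : ℝ) < k := by positivity
  have hlk : 0 < l / k := by positivity
  have := isProbabilityMeasure_mu hlk
  have hν : IsProbabilityMeasure ((mu (l / k)).map fun u : ℝ => u / k) :=
    Measure.isProbabilityMeasure_map (by fun_prop)
  refine ⟨(mu (l / k)).map fun u : ℝ => u / k, hν, ?_⟩
  have := isProbabilityMeasure_convPow ((mu (l / k)).map fun u : ℝ => u / k) k
  have h0 : (0 : ℝ) ∈ naturalParam (mu l) := by rw [naturalParam_mu hl]; exact paramBound_pos hl
  refine (ext_of_mgf_eventuallyEq h0 ?_).symm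
  filter_upwards [isOpen_Iio.mem_nhds (paramBound_pos hl)] with s hs
  obtain ⟨t, ht, rfl⟩ := exists_meanToParam_eq hl hs
  have e : mgf id ((mu (l / k)).map fun u : ℝ => u / k) (meanToParam l t) =
      mgf id (mu (l / k)) (meanToParam (l / k) t) := by
    rw [mgf_id_map (by fun_prop), mgf, mgf]
    refine integral_congr_ae (ae_of_all _ fun u => ?_)
    simp only [meanToParam, id_eq]
    congr 1
    ring
  rw [mgf_convPow, e, mgf_mu_meanToParam hl ht.1 ht.2, mgf_mu_meanToParam hlk ht.1 ht.2,
    ← Real.exp_nat_mul]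
  congr 1
  field_simp

/-! ### Uniqueness of the family -/

lemma integrableExpSet_tilted {ν : Measure ℝ} {θ : ℝ} (hθ : θ ∈ integrableExpSet id ν) :
    integrableExpSet id (ν.tilted fun u => θ * u) = (fun s => θ + s) ⁻¹' integrableExpSet id ν := by
  ext s
  simp only [integrableExpSet, mem_preimage, mem_ofPred_eq, id_eq]
  rw [integrable_tilted_iff (f := fun u => θ * u) hθ]
  simp only [smul_eq_mul, ← Real.exp_add, add_mul]

lemma naturalParam_tilted {ν : Measure ℝ} {θ : ℝ} (hθ : θ ∈ integrableExpSet id ν) :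
    naturalParam (ν.tilted fun u => θ * u) = (fun s => θ + s) ⁻¹' naturalParam ν := by
  rw [naturalParam, integrableExpSet_tilted hθ]
  exact ((Homeomorph.addLeft θ).preimage_interior _).symm

/-- Tilting the generating measure shifts the parameter and does not change the family. -/
lemma expFamily_tilted {ν : Measure ℝ} {θ : ℝ} (hθ : θ ∈ integrableExpSet id ν) :
    expFamily (ν.tilted fun u => θ * u) = expFamily ν := by
  have h : ∀ s, (ν.tilted fun u => θ * u).tilted (fun u => s * u) =
      ν.tilted fun u => (θ + s) * u := fun s => by
    rw [tilted_tilted (f := fun u => θ * u) hθ]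
    congr 1
    ext u
    simp [add_mul]
  ext P
  simp only [expFamily, naturalParam_tilted hθ, h, mem_preimage, mem_ofPred_eq]
  constructor
  · rintro ⟨s, hs, rfl⟩
    exact ⟨θ + s, hs, rfl⟩
  · rintro ⟨s, hs, rfl⟩
    exact ⟨s - θ, by simpa using hs, by simp⟩

lemma mgf_tilted {ν : Measure ℝ} (θ s : ℝ) :
    mgf id (ν.tilted fun u => θ * u) s = mgf id ν (θ + s) / mgf id ν θ := by
  simp only [mgf, id_eq]
  rw [integral_exp_tilted]
  simp only [Pi.add_apply, add_mul]

/-- Let `M` be the mean of the family of `ν` as a function of `θ`. As `M' = V(M)`, both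
`meanToParam l (M θ) - θ` and `l (M - M ^ 2 / 2) - log L(θ)` have derivative `0` on the parameter
interval. Hence the member of mean `1 / 2` has near `0` the Laplace transform of `mu l`, so it is
`mu l`. -/
lemma expFamily_eq_of_hasVarianceFunction {l : ℝ} (hl : 0 < l) {ν : Measure ℝ}
    (hν : GeneratesNEF ν)
    (h : HasVarianceFunction (expFamily ν) (Ioo 0 1) (fun m => m / (l * (1 - m)))) :
    expFamily ν = expFamily (mu l) := by
  have hν0 : ν ≠ 0 := by
    rintro rfl
    exact hν.nondegenerate 0 (by simp)
  have hν1 : NeZero ν := ⟨hν0⟩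
  set S := naturalParam ν
  have hSo : IsOpen S := isOpen_interior
  have hSc : IsPreconnected S := (convex_integrableExpSet.interior).isPreconnected
  set M := deriv (cgf id ν)
  have hMmem : ∀ θ ∈ S, M θ ∈ Ioo (0 : ℝ) 1 := fun θ hθ => by
    have := h.1.mapsTo (⟨θ, hθ, rfl⟩ : (ν.tilted fun u => θ * u) ∈ expFamily ν)
    simpa only [mean_tilted hθ] using this
  have hk : ∀ θ ∈ S, HasDerivAt (cgf id ν) (M θ) θ := fun θ hθ =>
    (analyticAt_cgf hθ).differentiableAt.hasDerivAt
  have hM' : ∀ θ ∈ S, HasDerivAt M (M θ / (l * (1 - M θ))) θ := fun θ hθ => by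
    have h1 := (h.2 _ (⟨θ, hθ, rfl⟩ : (ν.tilted fun u => θ * u) ∈ expFamily ν)).2
    rw [variance_tilted hθ, mean_tilted hθ, iteratedDeriv_succ, iteratedDeriv_one] at h1
    refine HasDerivAt.congr_deriv ?_ h1
    exact (analyticAt_cgf hθ).deriv.differentiableAt.hasDerivAt
  obtain ⟨_, ⟨θ₀, hθ₀, rfl⟩, hm₀⟩ := h.1.surjOn (show (1 / 2 : ℝ) ∈ Ioo (0 : ℝ) 1 by norm_num)
  have hm₀' : M θ₀ = 1 / 2 := by rw [← hm₀]; exact (mean_tilted hθ₀).symm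
  -- first integrals of the equation `M' = M / (l (1 - M))`
  have hparam : ∀ θ ∈ S, HasDerivAt (fun θ => meanToParam l (M θ) - θ) 0 θ := fun θ hθ => by
    have h1 := ((hasDerivAt_meanToParam l (hMmem θ hθ).1.ne').comp θ (hM' θ hθ)).sub
      (hasDerivAt_id θ)
    have h2 : 1 - M θ ≠ 0 := by linarith [(hMmem θ hθ).2]
    have h3 := (hMmem θ hθ).1.ne'
    refine h1.congr_deriv ?_
    field_simp
    ring
  have hcgf : ∀ θ ∈ S, HasDerivAt (fun θ => l * (M θ - M θ ^ 2 / 2 - 3 / 8) - cgf id ν θ) 0 θ :=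
    fun θ hθ => by
    have h1 := ((((hM' θ hθ).sub (((hM' θ hθ).pow 2).div_const 2)).sub_const (3 / 8)).const_mul
      l).sub (hk θ hθ)
    have h2 : 1 - M θ ≠ 0 := by linarith [(hMmem θ hθ).2]
    refine h1.congr_deriv ?_
    field_simp
    ring
  have hconst : ∀ f : ℝ → ℝ, (∀ θ ∈ S, HasDerivAt f 0 θ) → ∀ θ ∈ S, f θ = f θ₀ := by
    intro f hf θ hθ
    exact hSo.is_const_of_deriv_eq_zero hSc
      (fun x hx => (hf x hx).differentiableAt.differentiableWithinAt)
      (fun x hx => (hf x hx).deriv) hθ hθ₀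
  have hθ₀' : θ₀ ∈ integrableExpSet id ν := interior_subset hθ₀
  have hQ : IsProbabilityMeasure (ν.tilted fun u => θ₀ * u) := isProbabilityMeasure_tilted hθ₀'
  have hμ := isProbabilityMeasure_mu hl
  have h0 : (0 : ℝ) ∈ naturalParam (ν.tilted fun u => θ₀ * u) := by
    rw [naturalParam_tilted hθ₀']; simpa using hθ₀
  rw [← expFamily_tilted hθ₀']
  congr 1
  refine ext_of_mgf_eventuallyEq h0 ?_
  filter_upwards [isOpen_interior.mem_nhds h0] with s hs
  have hs' : θ₀ + s ∈ S := by
    have : s ∈ naturalParam (ν.tilted fun u => θ₀ * u) := hs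
    rwa [naturalParam_tilted hθ₀'] at this
  have h1 := hconst _ hparam _ hs'
  have h2 := hconst _ hcgf _ hs'
  rw [hm₀', meanToParam_half] at h1
  rw [hm₀'] at h2
  have h3 : s = meanToParam l (M (θ₀ + s)) := by linarith
  have hs'' : θ₀ + s ∈ integrableExpSet id ν := interior_subset hs'
  rw [mgf_tilted, ← exp_cgf hθ₀', ← exp_cgf hs'', ← Real.exp_sub]
  conv_rhs => rw [h3]
  rw [mgf_mu_meanToParam hl (hMmem _ hs').1 (hMmem _ hs').2]
  congr 1
  linarith

end RationalNEF

theorem mainTheorem5 (l : ℝ) (hl : 0 < l) :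
    (∀ n : ℕ, 0 ≤ RationalNEF.phi n l) ∧
    IsProbabilityMeasure (RationalNEF.mu l) ∧
    RationalNEF.IsInfinitelyDivisible (RationalNEF.mu l) ∧
    RationalNEF.GeneratesNEF (RationalNEF.mu l) ∧
    RationalNEF.HasVarianceFunction (RationalNEF.expFamily (RationalNEF.mu l)) (Ioo 0 1)
      (fun m : ℝ => m / (l * (1 - m))) ∧
    (∀ ν : Measure ℝ, RationalNEF.GeneratesNEF ν →
      RationalNEF.HasVarianceFunction (RationalNEF.expFamily ν) (Ioo 0 1)
        (fun m : ℝ => m / (l * (1 - m))) →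
      RationalNEF.expFamily ν = RationalNEF.expFamily (RationalNEF.mu l)) :=
  ⟨RationalNEF.phi_nonneg hl, RationalNEF.isProbabilityMeasure_mu hl,
    RationalNEF.isInfinitelyDivisible_mu hl, RationalNEF.generatesNEF_mu hl,
    RationalNEF.hasVarianceFunction_mu hl,
    fun _ hν h => RationalNEF.expFamily_eq_of_hasVarianceFunction hl hν h⟩
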